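/- Let $A$ be a commutative pro-$C^*$-algebra, that is, a commutative complete Hausdorff complex topological $*$-algebra (not necessarily unital) whose topology is determined by the set $S(A)$ of its continuous $C^*$-seminorms, and let $E$ be a Hilbert $A$-bimodule: a complex vector space that is both a left and a right Hilbert $A$-module, with left and right $A$-valued inner products ${}_A\langle\cdot,\cdot\rangle$ and $\langle\cdot,\cdot\rangle_A$ (each module being complete for the corresponding seminorms ${}^A\bar p(x)=\sqrt{p({}_A\langle x,x\rangle)}$, respectively $\bar p^A(x)=\sqrt{p(\langle x,x\rangle_A)}$, $p\in S(A)$), such that ${}_A\langle x,y\rangle z=x\langle y,z\rangle_A$ for all $x,y,z\in E$, and $\bar p^A(ax)\le p(a)\,\bar p^A(x)$ and ${}^A\bar p(xa)\le {}^A\bar p(x)\,p(a)$ for all $x\in E$, $a\in A$, $p\in S(A)$. Let $L_A(E)$ be the algebra of bounded adjointable right $A$-module maps on $E$, with the topology defined by the seminorms $\tilde p(T)=\sup\{\bar p^A(Tx): x\in E,\ \bar p^A(x)\le 1\}$, $p\in S(A)$, and let $K_A(E)$ be the closure in $L_A(E)$ of the linear span of the operators $\theta_{x,y}(\xi)=x\langle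 y,\xi\rangle_A$, $x,y\in E$. Then every derivation on $K_A(E)$, i.e. every linear map $D:K_A(E)\to K_A(E)$ with $D(ST)=D(S)T+SD(T)$ for all $S,T\in K_A(E)$ (continuity is not assumed), is zero. -/

import Mathlib

set_option linter.unusedSectionVars false

namespace ProCStar

section Definitions

variable (A : Type*) [NonUnitalRing A] [StarRing A] [Module ℂ A]
  [IsScalarTower ℂ A A] [SMulCommClass ℂ A A] [StarModule ℂ A]

/-- A continuous C*-seminorm on a complex topological *-algebra. The invariance
`p (star a) = p a` follows from the fields, see `ContCStarSeminorm.map_star`. -/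
structure ContCStarSeminorm [TopologicalSpace A] extends Seminorm ℂ A where
  continuous' : Continuous toFun
  mul_le' : ∀ a b : A, toFun (a * b) ≤ toFun a * toFun b
  star_mul_self' : ∀ a : A, toFun (star a * a) = toFun a ^ 2

noncomputable instance [TopologicalSpace A] : CoeFun (ContCStarSeminorm A) (fun _ => A → ℝ) :=
  ⟨fun p => p.toSeminorm⟩

/-- A pro-C*-algebra: a complete Hausdorff complex topological *-algebra in which a net (filter)
converges to `0` iff its image under every continuous C*-seminorm converges to `0`. -/
class ProCStarAlgebra [UniformSpace A] : Prop extends IsUniformAddGroup A, ContinuousMul A,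
    ContinuousStar A, ContinuousSMul ℂ A, CompleteSpace A, T2Space A where
  le_nhds_zero_iff : ∀ l : Filter A,
    l ≤ nhds 0 ↔ ∀ p : ContCStarSeminorm A, Filter.Tendsto p l (nhds 0)

/-- Positive elements of a pro-C*-algebra: those of the form `b* b`. -/
def IsPositiveElement {A : Type*} [NonUnitalRing A] [StarRing A] (a : A) : Prop :=
  ∃ b : A, a = star b * b

variable (E : Type*) [AddCommGroup E] [Module ℂ E]

/-- A right pre-Hilbert module; `rsmul x a` is `x a` and `rinner x y` is the inner product
`⟨x, y⟩_A`, linear in the second variable. -/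
class RightPreHilbertModule where
  rsmul : E → A → E
  rinner : E → E → A
  add_rsmul : ∀ (x y : E) (a : A), rsmul (x + y) a = rsmul x a + rsmul y a
  rsmul_add : ∀ (x : E) (a b : A), rsmul x (a + b) = rsmul x a + rsmul x b
  rsmul_mul : ∀ (x : E) (a b : A), rsmul x (a * b) = rsmul (rsmul x a) b
  smul_rsmul : ∀ (c : ℂ) (x : E) (a : A), rsmul (c • x) a = c • rsmul x a
  rsmul_smul : ∀ (c : ℂ) (x : E) (a : A), rsmul x (c • a) = c • rsmul x a
  rinner_add : ∀ x y z : E, rinner x (y + z) = rinner x y + rinner x z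
  rinner_smul : ∀ (c : ℂ) (x y : E), rinner x (c • y) = c • rinner x y
  rinner_rsmul : ∀ (x y : E) (a : A), rinner x (rsmul y a) = rinner x y * a
  star_rinner : ∀ x y : E, star (rinner y x) = rinner x y
  rinner_self_pos : ∀ x : E, IsPositiveElement (rinner x x)
  rinner_self_eq_zero : ∀ x : E, rinner x x = 0 ↔ x = 0

/-- A left pre-Hilbert module; `lsmul a x` is `a x` and `linner x y` is the inner product
`_A⟨x, y⟩`, linear in the first variable. -/
class LeftPreHilbertModule where
  lsmul : A → E → E
  linner : E → E → A
  lsmul_add : ∀ (a : A) (x y : E), lsmul a (x + y) = lsmul a x + lsmul a y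
  add_lsmul : ∀ (a b : A) (x : E), lsmul (a + b) x = lsmul a x + lsmul b x
  mul_lsmul : ∀ (a b : A) (x : E), lsmul (a * b) x = lsmul a (lsmul b x)
  lsmul_smul : ∀ (c : ℂ) (a : A) (x : E), lsmul a (c • x) = c • lsmul a x
  smul_lsmul : ∀ (c : ℂ) (a : A) (x : E), lsmul (c • a) x = c • lsmul a x
  add_linner : ∀ x y z : E, linner (x + y) z = linner x z + linner y z
  smul_linner : ∀ (c : ℂ) (x y : E), linner (c • x) y = c • linner x y
  lsmul_linner : ∀ (a : A) (x y : E), linner (lsmul a x) y = a * linner x y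
  star_linner : ∀ x y : E, star (linner y x) = linner x y
  linner_self_pos : ∀ x : E, IsPositiveElement (linner x x)
  linner_self_eq_zero : ∀ x : E, linner x x = 0 ↔ x = 0

variable {A E} in
/-- The seminorm `x ↦ √p(⟨x, x⟩_A)` on a right module. -/
noncomputable def rnorm [TopologicalSpace A] [RightPreHilbertModule A E]
    (p : ContCStarSeminorm A) (x : E) : ℝ :=
  Real.sqrt (p (RightPreHilbertModule.rinner x x))

variable {A E} in
/-- The seminorm `x ↦ √p(_A⟨x, x⟩)` on a left module. -/
noncomputable def lnorm [TopologicalSpace A] [LeftPreHilbertModule A E]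
    (p : ContCStarSeminorm A) (x : E) : ℝ :=
  Real.sqrt (p (LeftPreHilbertModule.linner x x))

variable {E} in
/-- Completeness with respect to a family of seminorms: every Cauchy filter converges. -/
def CompleteForSeminorms {ι : Type*} (q : ι → E → ℝ) : Prop :=
  ∀ F : Filter E, F.NeBot →
    (∀ i, ∀ ε : ℝ, 0 < ε → ∃ s ∈ F, ∀ x ∈ s, ∀ y ∈ s, q i (x - y) < ε) →
    ∃ x : E, ∀ i, Filter.Tendsto (fun y => q i (y - x)) F (nhds 0)

/-- A right Hilbert module: a right pre-Hilbert module that is complete for the seminorms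
`rnorm p`. -/
class RightHilbertModule [TopologicalSpace A] extends RightPreHilbertModule A E where
  complete_rnorm : CompleteForSeminorms (fun p : ContCStarSeminorm A => (rnorm p : E → ℝ))

/-- A left Hilbert module. -/
class LeftHilbertModule [TopologicalSpace A] extends LeftPreHilbertModule A E where
  complete_lnorm : CompleteForSeminorms (fun p : ContCStarSeminorm A => (lnorm p : E → ℝ))

/-- A Hilbert pro-C*-bimodule over `A`: a left and right Hilbert `A`-module such that
`_A⟨x, y⟩ z = x ⟨y, z⟩_A` and both module actions are contractive for each seminorm. -/
class HilbertBimodule [TopologicalSpace A] extends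
    RightHilbertModule A E, LeftHilbertModule A E where
  linner_lsmul : ∀ x y z : E, lsmul (linner x y) z = rsmul x (rinner y z)
  rnorm_lsmul_le : ∀ (p : ContCStarSeminorm A) (a : A) (x : E),
    rnorm p (lsmul a x) ≤ p a * rnorm p x
  lnorm_rsmul_le : ∀ (p : ContCStarSeminorm A) (a : A) (x : E),
    lnorm p (rsmul x a) ≤ lnorm p x * p a

end Definitions

section Completions

open UniformSpace

variable {B : Type*} [NormedRing B] [StarRing B] [CStarRing B] [NormedAlgebra ℂ B] [StarModule ℂ B]

/-- The involution on the completion of a normed *-algebra. -/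
noncomputable def complStar (x : Completion B) : Completion B := Completion.map (star : B → B) x

theorem uniformContinuous_cstar : UniformContinuous (star : B → B) :=
  (starNormedAddGroupHom (E := B)).uniformContinuous

theorem complStar_coe (b : B) : complStar (b : Completion B) = ((star b : B) : Completion B) :=
  Completion.map_coe uniformContinuous_cstar b

theorem complStar_cont : Continuous (complStar : Completion B → Completion B) :=
  Completion.continuous_map

/-- The completion of a normed algebra satisfying the C*-identity is a C*-algebra. -/
noncomputable abbrev complCStarAlgebra : CStarAlgebra (Completion B) where
  star := complStar
  star_involutive := fun x => by
    refine Completion.induction_on x (isClosed_eq (complStar_cont.comp complStar_cont) continuous_id)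
      (fun a => ?_)
    rw [complStar_coe, complStar_coe, star_star]
  star_mul := fun x y => by
    refine Completion.induction_on₂ x y (isClosed_eq (complStar_cont.comp continuous_mul)
        ((complStar_cont.comp continuous_snd).mul (complStar_cont.comp continuous_fst)))
      (fun a b => ?_)
    rw [← Completion.coe_mul, complStar_coe, complStar_coe, complStar_coe, star_mul,
      Completion.coe_mul]
  star_add := fun x y => by
    refine Completion.induction_on₂ x y (isClosed_eq (complStar_cont.comp continuous_add)
        ((complStar_cont.comp continuous_fst).add (complStar_cont.comp continuous_snd)))
      (fun a b => ?_)
    rw [← Completion.coe_add, complStar_coe, complStar_coe, complStar_coe, star_add,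
      Completion.coe_add]
  norm_mul_self_le := fun x => by
    change _ ≤ ‖complStar x * x‖
    refine Completion.induction_on x (isClosed_le
        (continuous_norm.mul continuous_norm)
        ((complStar_cont.mul continuous_id).norm)) (fun a => ?_)
    rw [complStar_coe, ← Completion.coe_mul, Completion.norm_coe, Completion.norm_coe,
      CStarRing.norm_star_mul_self]
  norm_smul_le := norm_smul_le
  star_smul := fun r x => by
    refine Completion.induction_on x (isClosed_eq
        (complStar_cont.comp (continuous_const_smul r))
        ((continuous_const_smul (star r)).comp complStar_cont)) (fun a => ?_)
    rw [← Completion.coe_smul, complStar_coe, complStar_coe, star_smul, Completion.coe_smul]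

theorem norm_star_mul_self_le_unital (b c : B) : ‖star b * b‖ ≤ ‖star b * b + star c * c‖ := by
  let : CStarAlgebra (Completion B) := complCStarAlgebra
  let _ := CStarAlgebra.spectralOrder (Completion B)
  have := CStarAlgebra.spectralOrderedRing (Completion B)
  have h := CStarAlgebra.norm_le_norm_of_nonneg_of_le (star_mul_self_nonneg (b : Completion B))
    (le_add_of_nonneg_right (star_mul_self_nonneg (c : Completion B)))
  have e : ∀ d : B, star (d : Completion B) = ((star d : B) : Completion B) := complStar_coe
  rw [e, e, ← Completion.coe_mul, ← Completion.coe_mul, ← Completion.coe_add,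
    Completion.norm_coe, Completion.norm_coe] at h
  exact h

end Completions

section NonUnital

variable {B : Type*} [NonUnitalNormedRing B] [StarRing B] [CStarRing B] [NormedSpace ℂ B]
  [IsScalarTower ℂ B B] [SMulCommClass ℂ B B] [StarModule ℂ B]

theorem norm_star_mul_self_le_nonunital (b c : B) : ‖star b * b‖ ≤ ‖star b * b + star c * c‖ := by
  have := norm_star_mul_self_le_unital (b : Unitization ℂ B) (c : Unitization ℂ B)
  rw [← Unitization.inr_star, ← Unitization.inr_star, ← Unitization.inr_mul,
    ← Unitization.inr_mul, ← Unitization.inr_add,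
    Unitization.norm_inr, Unitization.norm_inr] at this
  exact this

end NonUnital

section CStarSeminorms

variable {A : Type*} [NonUnitalRing A] [StarRing A] [Module ℂ A]
  [IsScalarTower ℂ A A] [SMulCommClass ℂ A A] [StarModule ℂ A]

theorem cstar_seminorm_star (p : Seminorm ℂ A) (hm : ∀ a b, p (a * b) ≤ p a * p b)
    (hs : ∀ a, p (star a * a) = p a ^ 2) (a : A) : p (star a) = p a := by
  have : ∀ a, p a ≤ p (star a) := fun a => by
    rcases (apply_nonneg p a).eq_or_lt with h | h
    · rw [← h]; exact apply_nonneg _ _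
    · have := hm (star a) a
      rw [hs, sq] at this
      exact le_of_mul_le_mul_right this h
  exact le_antisymm (by simpa using this (star a)) (this a)

/-- Monotonicity of C*-seminorms on positive elements. -/
theorem cstar_seminorm_mono (p : Seminorm ℂ A) (hm : ∀ a b, p (a * b) ≤ p a * p b)
    (hs : ∀ a, p (star a * a) = p a ^ 2) (b c : A) :
    p (star b * b) ≤ p (star b * b + star c * c) := by
  let i1 : NonUnitalSeminormedRing A :=
    { ‹NonUnitalRing A›, p.toSeminormedAddCommGroup with norm_mul_le := hm }
  let i2 : NormedSpace ℂ A := { norm_smul_le := fun r a => (map_smul_eq_mul p r a).le }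
  have hst := cstar_seminorm_star p hm hs
  let Q := SeparationQuotient A
  let st : Q → Q := SeparationQuotient.lift (fun a => SeparationQuotient.mk (star a)) (by
    intro x y h
    rw [SeparationQuotient.mk_eq_mk]
    rw [Metric.inseparable_iff, dist_eq_norm] at h ⊢
    rw [← star_sub]
    exact (hst _).trans h)
  have hst' : ∀ a : A, st (SeparationQuotient.mk a) = SeparationQuotient.mk (star a) := fun a => rfl
  let i3 : StarRing Q :=
    { star := st
      star_involutive := fun x => by
        obtain ⟨x, rfl⟩ := SeparationQuotient.surjective_mk x
        rw [hst', hst', star_star]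
      star_mul := fun x y => by
        obtain ⟨x, rfl⟩ := SeparationQuotient.surjective_mk x
        obtain ⟨y, rfl⟩ := SeparationQuotient.surjective_mk y
        change st _ = st _ * st _
        rw [← SeparationQuotient.mk_mul, hst', hst', hst', star_mul, SeparationQuotient.mk_mul]
      star_add := fun x y => by
        obtain ⟨x, rfl⟩ := SeparationQuotient.surjective_mk x
        obtain ⟨y, rfl⟩ := SeparationQuotient.surjective_mk y
        change st _ = st _ + st _
        rw [← SeparationQuotient.mk_add, hst', hst', hst', star_add, SeparationQuotient.mk_add] }
  have : CStarRing Q := ⟨fun x => by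
    obtain ⟨x, rfl⟩ := SeparationQuotient.surjective_mk x
    change _ ≤ ‖SeparationQuotient.mk (star x) * SeparationQuotient.mk x‖
    rw [← SeparationQuotient.mk_mul, SeparationQuotient.norm_mk, SeparationQuotient.norm_mk, ← sq]
    exact (hs x).ge⟩
  have : StarModule ℂ Q := ⟨fun r x => by
    obtain ⟨x, rfl⟩ := SeparationQuotient.surjective_mk x
    change st _ = star r • st _
    rw [← SeparationQuotient.mk_smul, hst', hst', star_smul, SeparationQuotient.mk_smul]⟩
  have : IsScalarTower ℂ Q Q := ⟨fun r x y => by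
    obtain ⟨x, rfl⟩ := SeparationQuotient.surjective_mk x
    obtain ⟨y, rfl⟩ := SeparationQuotient.surjective_mk y
    exact congrArg SeparationQuotient.mk (smul_mul_assoc r x y)⟩
  have : SMulCommClass ℂ Q Q := ⟨fun r x y => by
    obtain ⟨x, rfl⟩ := SeparationQuotient.surjective_mk x
    obtain ⟨y, rfl⟩ := SeparationQuotient.surjective_mk y
    exact congrArg SeparationQuotient.mk (mul_smul_comm r x y).symm⟩
  have := norm_star_mul_self_le_nonunital (SeparationQuotient.mk b : Q) (SeparationQuotient.mk c : Q)
  have e : ∀ d : A, star (SeparationQuotient.mk d : Q) = SeparationQuotient.mk (star d) := hst'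
  rw [e, e, ← SeparationQuotient.mk_mul, ← SeparationQuotient.mk_mul, ← SeparationQuotient.mk_add,
    SeparationQuotient.norm_mk, SeparationQuotient.norm_mk] at this
  exact this

end CStarSeminorms

section Operators

variable {A : Type*} [NonUnitalRing A] [StarRing A] [Module ℂ A]
  [IsScalarTower ℂ A A] [SMulCommClass ℂ A A] [StarModule ℂ A] [TopologicalSpace A]

theorem ContCStarSeminorm.mul_le (p : ContCStarSeminorm A) (a b : A) : p (a * b) ≤ p a * p b :=
  p.mul_le' a b

theorem ContCStarSeminorm.star_mul_self (p : ContCStarSeminorm A) (a : A) :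
    p (star a * a) = p a ^ 2 :=
  p.star_mul_self' a

theorem ContCStarSeminorm.map_star (p : ContCStarSeminorm A) (a : A) : p (star a) = p a :=
  cstar_seminorm_star p.toSeminorm p.mul_le p.star_mul_self a

theorem ContCStarSeminorm.map_real_smul (p : ContCStarSeminorm A) {r : ℝ} (hr : 0 ≤ r) (a : A) :
    p ((r : ℂ) • a) = r * p a := by
  have h := map_smul_eq_mul p.toSeminorm (r : ℂ) a
  rwa [Complex.norm_real, Real.norm_of_nonneg hr] at h

theorem ContCStarSeminorm.mono (p : ContCStarSeminorm A) {r : ℝ} (hr : 0 ≤ r) {u v : A}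
    (hu : IsPositiveElement u) (hv : IsPositiveElement v) :
    r * p u ≤ p ((r : ℂ) • u + v) := by
  obtain ⟨b, rfl⟩ := hu
  obtain ⟨c, rfl⟩ := hv
  have h := cstar_seminorm_mono p.toSeminorm p.mul_le p.star_mul_self
    (((Real.sqrt r : ℝ) : ℂ) • b) c
  have e : star (((Real.sqrt r : ℝ) : ℂ) • b) * (((Real.sqrt r : ℝ) : ℂ) • b)
      = (r : ℂ) • (star b * b) := by
    rw [star_smul, smul_mul_smul_comm]
    congr 1
    rw [Complex.star_def, Complex.conj_ofReal, ← Complex.ofReal_mul, Real.mul_self_sqrt hr]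
  rw [e] at h
  rw [← p.map_real_smul hr]
  exact h

variable {E : Type*} [AddCommGroup E] [Module ℂ E] [RightPreHilbertModule A E]

open RightPreHilbertModule

theorem add_rinner (x y z : E) : (rinner (x + y) z : A) = rinner x z + rinner y z := by
  rw [← star_rinner, rinner_add, star_add, star_rinner, star_rinner]

theorem smul_rinner (c : ℂ) (x y : E) : (rinner (c • x) y : A) = star c • rinner x y := by
  rw [← star_rinner, rinner_smul, star_smul, star_rinner]

theorem rsmul_rinner (x y : E) (a : A) : (rinner (rsmul x a) y : A) = star a * rinner x y := by
  rw [← star_rinner, rinner_rsmul, star_mul, star_rinner]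

theorem rnorm_nonneg (p : ContCStarSeminorm A) (x : E) : 0 ≤ rnorm p x := Real.sqrt_nonneg _

theorem rnorm_sq (p : ContCStarSeminorm A) (x : E) : rnorm p x ^ 2 = p (rinner x x) :=
  Real.sq_sqrt (apply_nonneg p.toSeminorm _)

theorem rnorm_smul (p : ContCStarSeminorm A) (c : ℂ) (x : E) :
    rnorm p (c • x) = ‖c‖ * rnorm p x := by
  refine (pow_left_inj₀ (rnorm_nonneg _ _)
    (mul_nonneg (norm_nonneg _) (rnorm_nonneg _ _)) two_ne_zero).1 ?_
  rw [mul_pow, rnorm_sq, rnorm_sq, rinner_smul, smul_rinner, smul_smul]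
  refine (map_smul_eq_mul p.toSeminorm _ _).trans ?_
  rw [norm_mul, norm_star, sq]

theorem rnorm_zero (p : ContCStarSeminorm A) : rnorm p (0 : E) = 0 := by
  have h := rnorm_smul p 0 (0 : E)
  rwa [smul_zero, norm_zero, zero_mul] at h

theorem rnorm_add_le (p : ContCStarSeminorm A) (x y : E) :
    rnorm p (x + y) ≤ rnorm p x + rnorm p y := by
  refine le_of_forall_pos_le_add fun ε hε => ?_
  set a := rnorm p x with ha
  set b := rnorm p y with hb
  have ha0 : 0 ≤ a := rnorm_nonneg _ _
  have hb0 : 0 ≤ b := rnorm_nonneg _ _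
  obtain ⟨s, hs⟩ : ∃ s, s = a + ε / 2 := ⟨_, rfl⟩
  obtain ⟨t, ht⟩ : ∃ t, t = b + ε / 2 := ⟨_, rfl⟩
  have hs0 : 0 < s := by linarith
  have ht0 : 0 < t := by linarith
  have h := p.mono (mul_nonneg hs0.le ht0.le) (rinner_self_pos (A := A) (x + y))
    (rinner_self_pos (A := A) ((t : ℂ) • x + ((-s : ℝ) : ℂ) • y))
  have e : (((s * t : ℝ) : ℂ) • rinner (x + y) (x + y)
      + rinner ((t : ℂ) • x + ((-s : ℝ) : ℂ) • y) ((t : ℂ) • x + ((-s : ℝ) : ℂ) • y) : A)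
      = ((t * (s + t) : ℝ) : ℂ) • rinner x x + ((s * (s + t) : ℝ) : ℂ) • rinner y y := by
    simp only [add_rinner, rinner_add, smul_rinner, rinner_smul, Complex.star_def,
      Complex.conj_ofReal]
    push_cast
    module
  rw [e, ← rnorm_sq] at h
  have h1 := h.trans (map_add_le_add p.toSeminorm _ _)
  have hst : 0 ≤ s + t := by linarith
  have h2 := p.map_real_smul (mul_nonneg ht0.le hst) (rinner x x)
  have h3 := p.map_real_smul (mul_nonneg hs0.le hst) (rinner y y)
  rw [← rnorm_sq] at h2 h3
  rw [h2, h3, ← ha, ← hb] at h1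
  have h4 : a ^ 2 ≤ s ^ 2 := by apply pow_le_pow_left₀ ha0; linarith
  have h5 : b ^ 2 ≤ t ^ 2 := by apply pow_le_pow_left₀ hb0; linarith
  have h6 : s * t * rnorm p (x + y) ^ 2 ≤ s * t * (s + t) ^ 2 :=
    calc _ ≤ _ := h1
      _ ≤ t * (s + t) * s ^ 2 + s * (s + t) * t ^ 2 := by gcongr
      _ = _ := by ring
  have h7 := (pow_le_pow_iff_left₀ (rnorm_nonneg p _) hst two_ne_zero).1
    (le_of_mul_le_mul_left h6 (mul_pos hs0 ht0))
  linarith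

theorem norm_rinner_le (p : ContCStarSeminorm A) (y z : E) :
    p (rinner y z) ≤ rnorm p y * rnorm p z := by
  refine (pow_le_pow_iff_left₀ (apply_nonneg p.toSeminorm _)
    (mul_nonneg (rnorm_nonneg _ _) (rnorm_nonneg _ _)) two_ne_zero).1 ?_
  rw [mul_pow, rnorm_sq, rnorm_sq]
  have key : ∀ s : ℝ, p (rinner z z) < s → p (rinner y z) ^ 2 ≤ p (rinner y y) * s := by
    intro s hs
    have hs0 : 0 < s := (apply_nonneg p.toSeminorm _).trans_lt hs
    have h := p.mono (u := star (rinner z y) * (rinner z y)) (r := 2 * s) (by linarith) ⟨_, rfl⟩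
      (rinner_self_pos (A := A) ((s : ℂ) • y + ((-1 : ℝ) : ℂ) • rsmul z (rinner z y : A)))
    have e : (((2 * s : ℝ) : ℂ) • (star (rinner z y) * (rinner z y))
        + rinner ((s : ℂ) • y + ((-1 : ℝ) : ℂ) • rsmul z (rinner z y : A))
          ((s : ℂ) • y + ((-1 : ℝ) : ℂ) • rsmul z (rinner z y : A)) : A)
        = ((s ^ 2 : ℝ) : ℂ) • rinner y y
          + star (rinner z y) * rinner z z * rinner z y := by
      simp only [add_rinner, rinner_add, smul_rinner, rinner_smul, rsmul_rinner, rinner_rsmul,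
        Complex.star_def, Complex.conj_ofReal, star_rinner, add_mul, smul_mul_assoc]
      push_cast
      module
    rw [e, p.star_mul_self] at h
    have h1 := h.trans (map_add_le_add p.toSeminorm _ _)
    have h2 := p.map_real_smul (sq_nonneg s) (rinner y y)
    have h3 : p (star (rinner z y) * rinner z z * rinner z y)
        ≤ p (rinner z y) * p (rinner z z) * p (rinner z y) := by
      refine (p.mul_le _ _).trans ?_
      refine mul_le_mul_of_nonneg_right ?_ (apply_nonneg p.toSeminorm _)
      refine (p.mul_le _ _).trans ?_
      rw [p.map_star]
    have h4 : p (rinner y z) = p (rinner z y) := by rw [← star_rinner, p.map_star]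
    rw [h4]
    rw [h2] at h1
    have h5 : p (rinner z y) * p (rinner z z) * p (rinner z y) ≤ s * p (rinner z y) ^ 2 := by
      have := mul_le_mul_of_nonneg_right hs.le (sq_nonneg (p (rinner z y)))
      nlinarith
    have h6 : s * p (rinner z y) ^ 2 ≤ s * (p (rinner y y) * s) := by
      have h7 := h1.trans (add_le_add_right (h3.trans h5) _)
      nlinarith
    exact le_of_mul_le_mul_left h6 hs0
  have hc : Filter.Tendsto (fun s : ℝ => p (rinner y y) * s)
      (nhdsWithin (p (rinner z z)) (Set.Ioi (p (rinner z z))))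
      (nhds (p (rinner y y) * p (rinner z z))) :=
    ((continuous_const.mul continuous_id).tendsto _).mono_left nhdsWithin_le_nhds
  exact ge_of_tendsto hc (Filter.eventually_of_mem self_mem_nhdsWithin key)

theorem rnorm_rsmul_le (p : ContCStarSeminorm A) (x : E) (a : A) :
    rnorm p (rsmul x a) ≤ rnorm p x * p a := by
  have ha := apply_nonneg p.toSeminorm a
  refine (pow_le_pow_iff_left₀ (rnorm_nonneg _ _) (mul_nonneg (rnorm_nonneg _ _) ha)
    two_ne_zero).1 ?_
  rw [mul_pow, rnorm_sq, rnorm_sq, rinner_rsmul, rsmul_rinner]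
  calc p (star a * rinner x x * a) ≤ p (star a * rinner x x) * p a := p.mul_le _ _
    _ ≤ (p (star a) * p (rinner x x)) * p a := mul_le_mul_of_nonneg_right (p.mul_le _ _) ha
    _ = _ := by rw [p.map_star]; ring

/-- `T` is adjointable if `⟨T x, y⟩ = ⟨x, S y⟩` for some map `S`. -/
def IsAdjointable (A : Type*) [NonUnitalRing A] [StarRing A] [Module ℂ A] {E : Type*}
    [AddCommGroup E] [Module ℂ E] [RightPreHilbertModule A E] (T : E → E) : Prop :=
  ∃ S : E → E, ∀ x y : E, (rinner (T x) y : A) = rinner x (S y)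

variable (A E) in
/-- The algebra `L_A(E)` of bounded adjointable `A`-module maps on `E`. -/
def AdjointableOperators : Subalgebra ℂ (Module.End ℂ E) where
  carrier := {T | (∀ (x : E) (a : A), T (rsmul x a) = rsmul (T x) a) ∧ IsAdjointable A T ∧
    ∀ p : ContCStarSeminorm A, ∃ k : ℝ, 0 < k ∧ ∀ x : E, rnorm p (T x) ≤ k * rnorm p x}
  mul_mem' := by
    rintro T T' ⟨h1, ⟨S, hS⟩, h3⟩ ⟨h1', ⟨S', hS'⟩, h3'⟩
    refine ⟨fun x a => ?_, ⟨fun y => S' (S y), fun x y => ?_⟩, fun p => ?_⟩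
    · simp only [Module.End.mul_apply, h1', h1]
    · simp only [Module.End.mul_apply, hS, hS']
    · obtain ⟨k, hk, hT⟩ := h3 p
      obtain ⟨k', hk', hT'⟩ := h3' p
      refine ⟨k * k', mul_pos hk hk', fun x => (hT _).trans ?_⟩
      rw [mul_assoc]
      exact mul_le_mul_of_nonneg_left (hT' x) hk.le
  add_mem' := by
    rintro T T' ⟨h1, ⟨S, hS⟩, h3⟩ ⟨h1', ⟨S', hS'⟩, h3'⟩
    refine ⟨fun x a => ?_, ⟨fun y => S y + S' y, fun x y => ?_⟩, fun p => ?_⟩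
    · simp only [LinearMap.add_apply, h1', h1, add_rsmul]
    · simp only [LinearMap.add_apply, add_rinner, rinner_add, hS, hS']
    · obtain ⟨k, hk, hT⟩ := h3 p
      obtain ⟨k', hk', hT'⟩ := h3' p
      refine ⟨k + k', add_pos hk hk', fun x => (rnorm_add_le p _ _).trans ?_⟩
      rw [add_mul]
      exact add_le_add (hT x) (hT' x)
  algebraMap_mem' := by
    intro c
    refine ⟨fun x a => ?_, ⟨fun y => star c • y, fun x y => ?_⟩, fun p => ?_⟩
    · simp only [Module.algebraMap_end_apply, smul_rsmul]
    · simp only [Module.algebraMap_end_apply, smul_rinner, rinner_smul]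
    · refine ⟨‖c‖ + 1, by positivity, fun x => ?_⟩
      rw [Module.algebraMap_end_apply, rnorm_smul, add_mul, one_mul]
      exact le_add_of_nonneg_right (rnorm_nonneg p x)

theorem bddAbove_opNorm (p : ContCStarSeminorm A) (T : AdjointableOperators A E) :
    BddAbove {r : ℝ | ∃ x : E, rnorm p x ≤ 1 ∧ r = rnorm p (T.1 x)} := by
  obtain ⟨k, hk, h⟩ := T.2.2.2 p
  refine ⟨k, ?_⟩
  rintro _ ⟨x, hx, rfl⟩
  exact (h x).trans (by nlinarith)

/-- The seminorm `T ↦ sup {rnorm p (T x) : rnorm p x ≤ 1}` on `L_A(E)`. -/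
noncomputable def opSeminorm (p : ContCStarSeminorm A) :
    Seminorm ℂ (AdjointableOperators A E) :=
  Seminorm.ofSMulLE
    (fun T => sSup {r : ℝ | ∃ x : E, rnorm p x ≤ 1 ∧ r = rnorm p (T.1 x)})
    (by
      refine le_antisymm (Real.sSup_le ?_ le_rfl) (Real.sSup_nonneg ?_)
      · rintro _ ⟨x, _, rfl⟩
        exact (rnorm_zero p).le
      · rintro _ ⟨x, _, rfl⟩
        exact rnorm_nonneg p _)
    (by
      intro T S
      refine csSup_le ⟨_, 0, (rnorm_zero p).le.trans zero_le_one, rfl⟩ ?_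
      rintro _ ⟨x, hx, rfl⟩
      exact (rnorm_add_le p _ _).trans (add_le_add
        (le_csSup (bddAbove_opNorm p T) ⟨x, hx, rfl⟩)
        (le_csSup (bddAbove_opNorm p S) ⟨x, hx, rfl⟩)))
    (by
      intro c T
      refine csSup_le ⟨_, 0, (rnorm_zero p).le.trans zero_le_one, rfl⟩ ?_
      rintro _ ⟨x, hx, rfl⟩
      refine (rnorm_smul p c (T.1 x)).le.trans (mul_le_mul_of_nonneg_left ?_ (norm_nonneg c))
      exact le_csSup (bddAbove_opNorm p T) ⟨x, hx, rfl⟩)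

theorem opSeminorm_apply (p : ContCStarSeminorm A) (T : AdjointableOperators A E) :
    opSeminorm p T = sSup {r : ℝ | ∃ x : E, rnorm p x ≤ 1 ∧ r = rnorm p (T.1 x)} :=
  rfl

theorem rnorm_apply_le (p : ContCStarSeminorm A) (T : AdjointableOperators A E) (x : E) :
    rnorm p (T.1 x) ≤ opSeminorm p T * rnorm p x := by
  rcases (rnorm_nonneg p x).eq_or_lt with h | h
  · obtain ⟨k, _, hk⟩ := T.2.2.2 p
    have := hk x
    rw [← h, mul_zero] at this ⊢
    exact this
  · have h1 : rnorm p (((rnorm p x)⁻¹ : ℝ) • x) = 1 := by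
      rw [← Complex.coe_smul, rnorm_smul, Complex.norm_real, norm_inv, Real.norm_of_nonneg h.le,
        inv_mul_cancel₀ h.ne']
    have h2 := le_csSup (bddAbove_opNorm p T) ⟨_, h1.le, rfl⟩
    rw [← opSeminorm_apply, ← Complex.coe_smul, map_smul, rnorm_smul, Complex.norm_real, norm_inv,
      Real.norm_of_nonneg h.le, inv_mul_le_iff₀ h] at h2
    rwa [mul_comm]

theorem opSeminorm_mul_le (p : ContCStarSeminorm A) (S T : AdjointableOperators A E) :
    opSeminorm p (S * T) ≤ opSeminorm p S * opSeminorm p T := by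
  rw [opSeminorm_apply p (S * T)]
  refine csSup_le ⟨_, 0, (rnorm_zero p).le.trans zero_le_one, rfl⟩ ?_
  rintro _ ⟨x, hx, rfl⟩
  refine (rnorm_apply_le p S (T.1 x)).trans
    (mul_le_mul_of_nonneg_left ?_ (apply_nonneg (opSeminorm p) S))
  exact le_csSup (bddAbove_opNorm p T) ⟨x, hx, rfl⟩

variable (A E) in
/-- The topology of `L_A(E)`, defined by the seminorms `opSeminorm p`. -/
@[reducible]
noncomputable def operatorTopology : TopologicalSpace (AdjointableOperators A E) :=
  SeminormFamily.moduleFilterBasis (𝕜 := ℂ) (F := AdjointableOperators A E)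
    (fun p : ContCStarSeminorm A => opSeminorm p) |>.topology

/-- The operator `θ_{x,y} : ξ ↦ x ⟨y, ξ⟩_A`. -/
def theta (x y : E) : AdjointableOperators A E where
  val :=
    { toFun := fun ξ => rsmul x (rinner y ξ : A)
      map_add' := fun ξ η => by rw [rinner_add, rsmul_add]
      map_smul' := fun c ξ => by rw [rinner_smul, rsmul_smul, RingHom.id_apply] }
  property := by
    refine ⟨fun ξ a => ?_, ⟨fun η => rsmul y (rinner x η : A), fun ξ η => ?_⟩, fun p => ?_⟩
    · change rsmul x (rinner y (rsmul ξ a) : A) = rsmul (rsmul x (rinner y ξ : A)) a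
      rw [rinner_rsmul, rsmul_mul]
    · change (rinner (rsmul x (rinner y ξ : A)) η : A) = _
      rw [rsmul_rinner, rinner_rsmul, star_rinner]
    · refine ⟨rnorm p x * rnorm p y + 1,
        add_pos_of_nonneg_of_pos (mul_nonneg (rnorm_nonneg _ _) (rnorm_nonneg _ _)) one_pos,
        fun ξ => ?_⟩
      have h1 := rnorm_rsmul_le p x (rinner y ξ : A)
      have h2 := mul_le_mul_of_nonneg_left (norm_rinner_le p y ξ) (rnorm_nonneg p x)
      have h3 := rnorm_nonneg p ξ
      change rnorm p (rsmul x (rinner y ξ : A)) ≤ _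
      linarith

variable (A E) in
/-- The linear span of the operators `θ_{x,y}`. -/
def finiteRankOperators : Submodule ℂ (AdjointableOperators A E) :=
  Submodule.span ℂ {T | ∃ x y : E, T = theta x y}

theorem theta_mul_theta (x y u v : E) :
    (theta x y * theta u v : AdjointableOperators A E) = theta (rsmul x (rinner y u : A)) v := by
  ext ξ
  change rsmul x (rinner y (rsmul u (rinner v ξ : A)) : A)
    = rsmul (rsmul x (rinner y u : A)) (rinner v ξ : A)
  rw [rinner_rsmul, rsmul_mul]

theorem finiteRankOperators_mul_mem {S T : AdjointableOperators A E}
    (hS : S ∈ finiteRankOperators A E) (hT : T ∈ finiteRankOperators A E) :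
    S * T ∈ finiteRankOperators A E := by
  have h := Submodule.mul_mem_mul hS hT
  rw [finiteRankOperators, Submodule.span_mul_span] at h
  refine Submodule.span_mono ?_ h
  rintro _ ⟨_, ⟨x, y, rfl⟩, _, ⟨u, v, rfl⟩, rfl⟩
  exact ⟨_, _, theta_mul_theta x y u v⟩

theorem continuous_mul_left_operator (S : AdjointableOperators A E) :
    @Continuous _ _ (operatorTopology A E) (operatorTopology A E) (fun T => S * T) := by
  let _ := operatorTopology A E
  have hw : WithSeminorms (𝕜 := ℂ) (E := AdjointableOperators A E)
    (fun p : ContCStarSeminorm A => opSeminorm p) := ⟨rfl⟩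
  refine WithSeminorms.continuous_of_isBounded hw hw (LinearMap.mulLeft ℂ S) fun p => ?_
  refine ⟨{p}, ⟨opSeminorm p S, apply_nonneg _ _⟩, fun T => ?_⟩
  rw [Finset.sup_singleton]
  exact opSeminorm_mul_le p S T

theorem continuous_mul_right_operator (S : AdjointableOperators A E) :
    @Continuous _ _ (operatorTopology A E) (operatorTopology A E) (fun T => T * S) := by
  let _ := operatorTopology A E
  have hw : WithSeminorms (𝕜 := ℂ) (E := AdjointableOperators A E)
    (fun p : ContCStarSeminorm A => opSeminorm p) := ⟨rfl⟩
  refine WithSeminorms.continuous_of_isBounded hw hw (LinearMap.mulRight ℂ S) fun p => ?_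
  refine ⟨{p}, ⟨opSeminorm p S, apply_nonneg _ _⟩, fun T => ?_⟩
  have := opSeminorm_mul_le p T S
  rw [mul_comm (opSeminorm p T)] at this
  rw [Finset.sup_singleton]
  exact this

variable (A E) in
/-- The algebra `K_A(E)` of compact operators: the closure in `L_A(E)` of the linear span of the
operators `θ_{x,y}`. -/
def CompactOperators : NonUnitalSubalgebra ℂ (AdjointableOperators A E) where
  carrier := @closure _ (operatorTopology A E) (finiteRankOperators A E)
  add_mem' := by
    let _ := operatorTopology A E
    have hw : WithSeminorms (𝕜 := ℂ) (E := AdjointableOperators A E)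
      (fun p : ContCStarSeminorm A => opSeminorm p) := ⟨rfl⟩
    have := hw.topologicalAddGroup
    have := hw.continuousSMul
    exact fun {S T} hS hT => (finiteRankOperators A E).topologicalClosure.add_mem hS hT
  zero_mem' := @subset_closure _ (operatorTopology A E) _ _ (finiteRankOperators A E).zero_mem
  smul_mem' := by
    let _ := operatorTopology A E
    have hw : WithSeminorms (𝕜 := ℂ) (E := AdjointableOperators A E)
      (fun p : ContCStarSeminorm A => opSeminorm p) := ⟨rfl⟩
    have := hw.topologicalAddGroup
    have := hw.continuousSMul
    exact fun c T hT => (finiteRankOperators A E).topologicalClosure.smul_mem c hT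
  mul_mem' := by
    let _ := operatorTopology A E
    intro S T hS hT
    have h1 : ∀ R ∈ finiteRankOperators A E,
        R * T ∈ closure (finiteRankOperators A E : Set (AdjointableOperators A E)) := fun R hR =>
      map_mem_closure (continuous_mul_left_operator R) hT
        fun Q hQ => finiteRankOperators_mul_mem hR hQ
    have h2 := map_mem_closure (continuous_mul_right_operator T) hS h1
    rwa [closure_closure] at h2

end Operators

/-- A derivation on a complex algebra: a linear map `D` from the algebra into itself with
`D (a b) = D(a) b + a D(b)`. -/
def IsDerivation {B : Type*} [NonUnitalNonAssocSemiring B] [Module ℂ B] (D : B →ₗ[ℂ] B) : Prop :=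
  ∀ a b : B, D (a * b) = D a * b + a * D b

end ProCStar

/-! Write `L_a` for left multiplication by `a` on `E`. The compatibility of the two inner products
says `θ_{x,y} = L_b` with `b = _A⟨x, y⟩`. So `K_A(E)` is the closure of the operators `L_b` with `b`
in the span `J` of the left inner products. As `A` is commutative, every compact operator commutes
with every `L_a` (`compact_mul_lsmulOperator`).

The rest adapts the classical argument that a commutative C*-algebra has no nonzero derivations. Let
`b ∈ J` be self-adjoint and let `χ` be a character of `A`, dominated by some `p`, with `χ(b) = 0`.
Functional calculus gives a cube root `g` of `b` with `χ(g) = 0`. It is a limit of elements of `J`,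
so `L_g` is compact and the Leibniz rule gives `D(L_b) = L_g S` for some compact `S`. Hence `χ`
kills `_A⟨D(L_b)u, v⟩` for all `u, v` (`IsDerivation.character_apply_eq_zero`). With no unit
available, `a - χ(a)` is replaced by `a² - χ(a)a`, which also vanishes at `χ`. Expanding `D` on it
gives `χ(a) χ(_A⟨D(L_a)u, v⟩) = 0`. Characters separate the points of `A`, so `D(L_a) = 0` for
self-adjoint `a ∈ J`, and then for all `a ∈ J`.

For arbitrary compact `T`, the identity `T θ_{x,z} = θ_{Tx,z}` yields `D(T) θ_{x,z} = 0`. Taking `z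
= D(T)x` and applying both sides to `z` gives `z⟨z, z⟩_A = 0`, so `z = 0`. Continuity of `D` never
enters. -/

namespace ProCStar

/-! ### Characters attaining a given C*-seminorm. -/

section Characters

open UniformSpace

/-- A commutative normed algebra satisfying the C*-identity has enough contractive *-characters. -/
theorem exists_starAlgHom_norm_eq {B : Type*} [NormedRing B] [StarRing B] [CStarRing B]
    [NormedAlgebra ℂ B] [StarModule ℂ B] [Nontrivial B] (hcomm : ∀ a b : B, a * b = b * a) (a : B) :
    ∃ χ : B →⋆ₐ[ℂ] ℂ, ‖χ a‖ = ‖a‖ ∧ ∀ b, ‖χ b‖ ≤ ‖b‖ := by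
  let i : CommCStarAlgebra (Completion B) :=
    { complCStarAlgebra with
      mul_comm := fun x y => Completion.induction_on₂ x y
        (isClosed_eq continuous_mul (continuous_snd.mul continuous_fst)) fun a b => by
          rw [← Completion.coe_mul, hcomm, Completion.coe_mul] }
  have hnt : Nontrivial (Completion B) := (Completion.coe_injective B).nontrivial
  -- A spectral value of maximal modulus has modulus equal to the norm, since `a` is normal; by
  -- Gelfand theory it is the value of a character at `a`.
  obtain ⟨z, hz, hz'⟩ := spectrum.exists_nnnorm_eq_spectralRadius (a : Completion B)
  have hn : IsStarNormal (a : Completion B) := ⟨mul_comm _ _⟩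
  rw [IsStarNormal.spectralRadius_eq_nnnorm] at hz'
  obtain ⟨φ, hφ⟩ := WeakDual.CharacterSpace.mem_spectrum_iff_exists.1 hz
  let χ : B →⋆ₐ[ℂ] ℂ :=
    { toFun := fun b => φ (b : Completion B)
      map_one' := by rw [Completion.coe_one, map_one]
      map_mul' := fun x y => by rw [Completion.coe_mul, map_mul]
      map_zero' := by rw [Completion.coe_zero, map_zero]
      map_add' := fun x y => by rw [Completion.coe_add, map_add]
      commutes' := fun c => by
        rw [Algebra.algebraMap_eq_smul_one, Completion.coe_smul, Completion.coe_one, map_smul,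
          map_one, Algebra.algebraMap_eq_smul_one]
      map_star' := fun x => by
        have e : ((star x : B) : Completion B) = star (x : Completion B) := (complStar_coe x).symm
        rw [e, map_star] }
  refine ⟨χ, ?_, fun b => ?_⟩
  · change ‖φ (a : Completion B)‖ = ‖a‖
    rw [hφ]
    have h : ‖z‖₊ = ‖(a : Completion B)‖₊ := by exact_mod_cast hz'
    have h' : ‖z‖ = ‖(a : Completion B)‖ := congrArg NNReal.toReal h
    rw [h', Completion.norm_coe]
  · change ‖φ (b : Completion B)‖ ≤ ‖b‖
    rw [← Completion.norm_coe b]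
    exact spectrum.norm_le_norm_of_mem (AlgHom.apply_mem_spectrum φ (b : Completion B))

/-- `B` embeds isometrically in its unitization, which is again commutative and satisfies the
C*-identity; a character found there is restricted to `B`. -/
theorem exists_nonUnitalStarAlgHom_norm_eq {B : Type*} [NonUnitalNormedRing B] [StarRing B]
    [CStarRing B] [NormedSpace ℂ B] [IsScalarTower ℂ B B] [SMulCommClass ℂ B B] [StarModule ℂ B]
    (hcomm : ∀ a b : B, a * b = b * a) (a : B) :
    ∃ χ : B →⋆ₙₐ[ℂ] ℂ, ‖χ a‖ = ‖a‖ ∧ ∀ b, ‖χ b‖ ≤ ‖b‖ := by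
  have hc : ∀ x y : Unitization ℂ B, x * y = y * x := fun x y => by
    ext
    · simp [mul_comm]
    · simp only [Unitization.snd_mul, hcomm x.snd y.snd]
      abel
  obtain ⟨χ, h1, h2⟩ := exists_starAlgHom_norm_eq hc (a : Unitization ℂ B)
  refine ⟨(χ : Unitization ℂ B →⋆ₙₐ[ℂ] ℂ).comp (Unitization.inrNonUnitalStarAlgHom ℂ B), ?_, fun b => ?_⟩
  · rw [← Unitization.norm_inr (𝕜 := ℂ) a]; exact h1
  · rw [← Unitization.norm_inr (𝕜 := ℂ) b]; exact h2 _

variable {A : Type*} [NonUnitalRing A] [StarRing A] [Module ℂ A]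
  [IsScalarTower ℂ A A] [SMulCommClass ℂ A A] [StarModule ℂ A]

/-- Dividing by the kernel of `p` turns `p` into a norm with the C*-identity, and characters of the
quotient pull back to `A`. -/
theorem cstar_seminorm_exists_character (p : Seminorm ℂ A)
    (hm : ∀ a b, p (a * b) ≤ p a * p b) (hs : ∀ a, p (star a * a) = p a ^ 2)
    (hcomm : ∀ a b : A, a * b = b * a) (a : A) :
    ∃ χ : A →⋆ₙₐ[ℂ] ℂ, ‖χ a‖ = p a ∧ ∀ b, ‖χ b‖ ≤ p b := by
  let i1 : NonUnitalSeminormedRing A :=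
    { ‹NonUnitalRing A›, p.toSeminormedAddCommGroup with norm_mul_le := hm }
  let i2 : NormedSpace ℂ A := { norm_smul_le := fun r a => (map_smul_eq_mul p r a).le }
  have hst := cstar_seminorm_star p hm hs
  let Q := SeparationQuotient A
  let st : Q → Q := SeparationQuotient.lift (fun a => SeparationQuotient.mk (star a)) (by
    intro x y h
    rw [SeparationQuotient.mk_eq_mk]
    rw [Metric.inseparable_iff, dist_eq_norm] at h ⊢
    rw [← star_sub]
    exact (hst _).trans h)
  have hst' : ∀ a : A, st (SeparationQuotient.mk a) = SeparationQuotient.mk (star a) := fun a => rfl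
  let i3 : StarRing Q :=
    { star := st
      star_involutive := fun x => by
        obtain ⟨x, rfl⟩ := SeparationQuotient.surjective_mk x
        rw [hst', hst', star_star]
      star_mul := fun x y => by
        obtain ⟨x, rfl⟩ := SeparationQuotient.surjective_mk x
        obtain ⟨y, rfl⟩ := SeparationQuotient.surjective_mk y
        change st _ = st _ * st _
        rw [← SeparationQuotient.mk_mul, hst', hst', hst', star_mul, SeparationQuotient.mk_mul]
      star_add := fun x y => by
        obtain ⟨x, rfl⟩ := SeparationQuotient.surjective_mk x
        obtain ⟨y, rfl⟩ := SeparationQuotient.surjective_mk y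
        change st _ = st _ + st _
        rw [← SeparationQuotient.mk_add, hst', hst', hst', star_add, SeparationQuotient.mk_add] }
  have : CStarRing Q := ⟨fun x => by
    obtain ⟨x, rfl⟩ := SeparationQuotient.surjective_mk x
    change _ ≤ ‖SeparationQuotient.mk (star x) * SeparationQuotient.mk x‖
    rw [← SeparationQuotient.mk_mul, SeparationQuotient.norm_mk, SeparationQuotient.norm_mk, ← sq]
    exact (hs x).ge⟩
  have : StarModule ℂ Q := ⟨fun r x => by
    obtain ⟨x, rfl⟩ := SeparationQuotient.surjective_mk x
    change st _ = star r • st _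
    rw [← SeparationQuotient.mk_smul, hst', hst', star_smul, SeparationQuotient.mk_smul]⟩
  have : IsScalarTower ℂ Q Q := ⟨fun r x y => by
    obtain ⟨x, rfl⟩ := SeparationQuotient.surjective_mk x
    obtain ⟨y, rfl⟩ := SeparationQuotient.surjective_mk y
    exact congrArg SeparationQuotient.mk (smul_mul_assoc r x y)⟩
  have : SMulCommClass ℂ Q Q := ⟨fun r x y => by
    obtain ⟨x, rfl⟩ := SeparationQuotient.surjective_mk x
    obtain ⟨y, rfl⟩ := SeparationQuotient.surjective_mk y
    exact congrArg SeparationQuotient.mk (mul_smul_comm r x y).symm⟩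
  have hc : ∀ x y : Q, x * y = y * x := fun x y => by
    obtain ⟨x, rfl⟩ := SeparationQuotient.surjective_mk x
    obtain ⟨y, rfl⟩ := SeparationQuotient.surjective_mk y
    exact congrArg SeparationQuotient.mk (hcomm x y)
  obtain ⟨χ, h1, h2⟩ := exists_nonUnitalStarAlgHom_norm_eq hc (SeparationQuotient.mk a : Q)
  let π : A →⋆ₙₐ[ℂ] Q :=
    { toFun := SeparationQuotient.mk
      map_smul' := fun _ _ => rfl
      map_zero' := rfl
      map_add' := fun _ _ => rfl
      map_mul' := fun _ _ => rfl
      map_star' := fun _ => rfl }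
  exact ⟨χ.comp π, h1.trans (SeparationQuotient.norm_mk a),
    fun b => (h2 _).trans (SeparationQuotient.norm_mk b).le⟩

end Characters

/-! ### Separation by characters and functional calculus in a commutative pro-C*-algebra. -/

section FunctionalCalculus

open Filter Topology

variable {A : Type*} [NonUnitalRing A] [StarRing A] [Module ℂ A]
  [IsScalarTower ℂ A A] [SMulCommClass ℂ A A] [StarModule ℂ A]

theorem ContCStarSeminorm.exists_character [TopologicalSpace A] (hcomm : ∀ a b : A, a * b = b * a)
    (p : ContCStarSeminorm A) (a : A) :
    ∃ χ : A →⋆ₙₐ[ℂ] ℂ, ‖χ a‖ = p a ∧ ∀ b, ‖χ b‖ ≤ p b :=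
  cstar_seminorm_exists_character p.toSeminorm p.mul_le p.star_mul_self hcomm a

theorem eq_zero_of_seminorms [UniformSpace A] [ProCStarAlgebra A] {a : A}
    (h : ∀ p : ContCStarSeminorm A, p a = 0) : a = 0 := by
  -- The constant filter at `a` converges to `0` in every seminorm, so `a = 0` because `A` is
  -- Hausdorff.
  have h1 : pure a ≤ 𝓝 (0 : A) := (ProCStarAlgebra.le_nhds_zero_iff _).2 fun p => by
    rw [tendsto_pure_left]
    intro s hs
    rw [h p]
    exact mem_of_mem_nhds hs
  exact (pure_le_nhds_iff.1 h1)

theorem eq_zero_of_characters [UniformSpace A] [ProCStarAlgebra A]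
    (hcomm : ∀ a b : A, a * b = b * a) {a : A}
    (h : ∀ (p : ContCStarSeminorm A) (χ : A →⋆ₙₐ[ℂ] ℂ), (∀ b, ‖χ b‖ ≤ p b) → χ a = 0) :
    a = 0 :=
  eq_zero_of_seminorms fun p => by
    obtain ⟨χ, h1, h2⟩ := p.exists_character hcomm a
    rw [← h1, h p χ h2, norm_zero]

theorem eq_zero_of_star_mul_self [UniformSpace A] [ProCStarAlgebra A] {a : A}
    (h : star a * a = 0) : a = 0 :=
  eq_zero_of_seminorms fun p => by
    have h1 := p.star_mul_self a
    rw [h] at h1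
    exact pow_eq_zero_iff two_ne_zero |>.1 (h1.symm.trans (map_zero p.toSeminorm))

theorem character_selfAdjoint (χ : A →⋆ₙₐ[ℂ] ℂ) {b : A} (hb : star b = b) :
    ((χ b).re : ℂ) = χ b := by
  rw [← Complex.conj_eq_iff_re, ← Complex.star_def, ← map_star, hb]

/-- Polynomials without constant term act on the elements of a subspace closed under right
multiplication by one of its members. -/
theorem exists_polynomial_apply (I : Submodule ℂ A) {b : A} (hb : b ∈ I)
    (hI : ∀ c ∈ I, c * b ∈ I) (hbs : star b = b) (P : Polynomial ℝ) :
    ∃ c ∈ I, ∀ χ : A →⋆ₙₐ[ℂ] ℂ, χ c = (((χ b).re * P.eval (χ b).re : ℝ) : ℂ) := by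
  induction P using Polynomial.induction_on' with
  | add P Q hP hQ =>
    obtain ⟨c, hc, h⟩ := hP
    obtain ⟨d, hd, h'⟩ := hQ
    refine ⟨c + d, I.add_mem hc hd, fun χ => ?_⟩
    rw [map_add, h, h', Polynomial.eval_add]
    push_cast
    ring
  | monomial n r =>
    induction n with
    | zero =>
      refine ⟨(r : ℂ) • b, I.smul_mem _ hb, fun χ => ?_⟩
      rw [map_smul, Polynomial.eval_monomial]
      push_cast
      rw [character_selfAdjoint χ hbs, smul_eq_mul]
      ring
    | succ n ih =>
      obtain ⟨c, hc, h⟩ := ih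
      refine ⟨c * b, hI c hc, fun χ => ?_⟩
      rw [map_mul, h, Polynomial.eval_monomial, Polynomial.eval_monomial,
        ← character_selfAdjoint χ hbs]
      simp only [Complex.ofReal_re]
      push_cast
      ring

/-- Weierstrass approximation on `[-n, n]`. The interval grows with `n` because `b` need not be
bounded uniformly over all continuous C*-seminorms; one sequence then serves every seminorm. -/
theorem exists_approx_apply (I : Submodule ℂ A) {b : A} (hb : b ∈ I)
    (hI : ∀ c ∈ I, c * b ∈ I) (hbs : star b = b) {f : ℝ → ℝ} (hf : Continuous f) (hf0 : f 0 = 0)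
    (n : ℕ) :
    ∃ c ∈ I, ∀ χ : A →⋆ₙₐ[ℂ] ℂ, ‖χ b‖ ≤ n → ‖χ c - f (χ b).re‖ ≤ 1 / ((n : ℝ) + 1) := by
  -- Half the tolerance is for `P - f`, the other half for removing the constant term `P(0)`, which
  -- is small since `f(0) = 0`.
  have hε : (0 : ℝ) < 1 / (n + 1) / 2 := by positivity
  obtain ⟨P, hP⟩ := exists_polynomial_near_of_continuousOn (-n) n f hf.continuousOn _ hε
  obtain ⟨c, hc, h⟩ := exists_polynomial_apply I hb hI hbs P.divX
  refine ⟨c, hc, fun χ hχ => ?_⟩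
  have hx := abs_le.1 ((Complex.abs_re_le_norm (χ b)).trans hχ)
  have h1 := hP _ ⟨hx.1, hx.2⟩
  have h2 := hP 0 ⟨by simp, by simp⟩
  rw [hf0, sub_zero] at h2
  have h3 : (χ b).re * P.divX.eval (χ b).re = P.eval (χ b).re - P.eval 0 := by
    conv_rhs => rw [← P.divX_mul_X_add]
    simp
    ring
  rw [h, ← Complex.ofReal_sub, Complex.norm_real, h3, Real.norm_eq_abs]
  rw [abs_lt] at h1 h2
  rw [abs_le]
  constructor <;> linarith

/-- Continuous functional calculus for a self-adjoint element of a commutative pro-C*-algebra. -/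
theorem exists_tendsto_apply [UniformSpace A] [ProCStarAlgebra A]
    (hcomm : ∀ a b : A, a * b = b * a) (I : Submodule ℂ A) {b : A} (hb : b ∈ I)
    (hI : ∀ c ∈ I, c * b ∈ I) (hbs : star b = b) {f : ℝ → ℝ} (hf : Continuous f) (hf0 : f 0 = 0) :
    ∃ (c : ℕ → A) (g : A), (∀ n, c n ∈ I) ∧
      (∀ p : ContCStarSeminorm A, Tendsto (fun n => p (c n - g)) atTop (𝓝 0)) ∧
      ∀ (p : ContCStarSeminorm A) (χ : A →⋆ₙₐ[ℂ] ℂ), (∀ a, ‖χ a‖ ≤ p a) →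
        χ g = f (χ b).re := by
  choose c hcI hc using exists_approx_apply I hb hI hbs hf hf0
  have hcauchy : CauchySeq c := by
    rw [cauchySeq_iff_tendsto, uniformity_eq_comap_nhds_zero, tendsto_comap_iff]
    refine (ProCStarAlgebra.le_nhds_zero_iff _).2 fun p => ?_
    have hlim : Tendsto (fun m : ℕ × ℕ => 1 / ((m.2 : ℝ) + 1) + 1 / ((m.1 : ℝ) + 1)) atTop (𝓝 0) := by
      rw [← prod_atTop_atTop_eq, ← add_zero (0 : ℝ)]
      exact (tendsto_one_div_add_atTop_nhds_zero_nat.comp tendsto_snd).add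
        (tendsto_one_div_add_atTop_nhds_zero_nat.comp tendsto_fst)
    -- From index `N` on, every character dominated by `p` sends `b` into the interval where the
    -- approximation is valid.
    obtain ⟨N, hN⟩ := exists_nat_ge (p b)
    refine tendsto_map'_iff.2 (squeeze_zero'
      (Eventually.of_forall fun _ => apply_nonneg p.toSeminorm _) ?_ hlim)
    filter_upwards [eventually_ge_atTop (N, N)] with m hm
    obtain ⟨χ, h1, h2⟩ := p.exists_character hcomm (c m.2 - c m.1)
    have hle : ∀ k, N ≤ k → ‖χ b‖ ≤ k := fun k hk =>
      (h2 b).trans (hN.trans (Nat.cast_le.2 hk))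
    change p (c m.2 - c m.1) ≤ _
    rw [← h1, map_sub]
    refine (norm_sub_le_norm_sub_add_norm_sub _ ((f (χ b).re : ℝ) : ℂ) _).trans
      (add_le_add (hc _ χ (hle _ hm.2)) ?_)
    rw [norm_sub_rev]
    exact hc _ χ (hle _ hm.1)
  obtain ⟨g, hg⟩ := cauchySeq_tendsto_of_complete hcauchy
  have hp : ∀ p : ContCStarSeminorm A, Tendsto (fun n => p (c n - g)) atTop (𝓝 0) := fun p => by
    have h1 : Tendsto (fun n => c n - g) atTop (𝓝 0) := by
      simpa using hg.sub_const g
    exact ((ProCStarAlgebra.le_nhds_zero_iff _).1 h1 p)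
  refine ⟨c, g, hcI, hp, fun p χ hχ => ?_⟩
  have h1 : Tendsto (fun n => χ (c n)) atTop (𝓝 (χ g)) := by
    rw [tendsto_iff_norm_sub_tendsto_zero]
    refine squeeze_zero (fun _ => norm_nonneg _) (fun n => ?_) (hp p)
    rw [← map_sub]
    exact hχ _
  refine tendsto_nhds_unique h1 ?_
  rw [tendsto_iff_norm_sub_tendsto_zero]
  refine squeeze_zero' (Eventually.of_forall fun _ => norm_nonneg _) ?_
    tendsto_one_div_add_atTop_nhds_zero_nat
  obtain ⟨N, hN⟩ := exists_nat_ge (p b)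
  filter_upwards [eventually_ge_atTop N] with n hn
  exact hc n χ ((hχ b).trans (hN.trans (Nat.cast_le.2 hn)))

end FunctionalCalculus
-- Compact operators as limits of left multiplications.
section LeftMultiplication

open RightPreHilbertModule LeftPreHilbertModule Filter Topology

variable {A E : Type*} [NonUnitalRing A] [StarRing A] [Module ℂ A] [IsScalarTower ℂ A A]
  [SMulCommClass ℂ A A] [StarModule ℂ A] [UniformSpace A] [ProCStarAlgebra A]
  [AddCommGroup E] [Module ℂ E]

theorem rinner_left_ext [RightPreHilbertModule A E] {x y : E}
    (h : ∀ z : E, (rinner z x : A) = rinner z y) : x = y := by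
  have h1 : x + (-1 : ℂ) • y = 0 := by
    rw [← rinner_self_eq_zero (A := A), rinner_add, rinner_smul, h]
    module
  rw [← sub_eq_zero, ← h1]
  module

/-- The self-adjoint element `⟨x, x⟩` has square `⟨x, x⟨x, x⟩⟩ = 0`. -/
theorem eq_zero_of_rsmul_rinner_self [RightPreHilbertModule A E] {x : E}
    (h : rsmul x (rinner x x : A) = 0) : x = 0 := by
  rw [← rinner_self_eq_zero (A := A)]
  refine eq_zero_of_star_mul_self ?_
  rw [star_rinner, ← rinner_rsmul, h]
  have := rinner_smul (A := A) (0 : ℂ) x (0 : E)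
  rwa [zero_smul, zero_smul] at this

variable [HilbertBimodule A E]

/-- Adjointability of left multiplication is not an axiom; it follows from compatibility, since
`z⟨ax, y⟩ = _A⟨z, ax⟩y = _A⟨z, x⟩a*y = z⟨x, a*y⟩` for every `z`. -/
theorem rinner_lsmul (a : A) (x y : E) :
    (rinner (lsmul a x) y : A) = rinner x (lsmul (star a) y) := by
  have key : ∀ z : E, rsmul z (rinner (lsmul a x) y : A) = rsmul z (rinner x (lsmul (star a) y) : A) := by
    intro z
    rw [← HilbertBimodule.linner_lsmul, ← HilbertBimodule.linner_lsmul,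
      ← star_linner (A := A) z (lsmul a x), lsmul_linner, star_mul, star_linner, mul_lsmul]
  have key' : ∀ w z : E, (rinner w z : A) * rinner (lsmul a x) y
      = rinner w z * rinner x (lsmul (star a) y) := fun w z => by
    rw [← rinner_rsmul, key, rinner_rsmul]
  rw [← sub_eq_zero]
  -- The difference `d` of the two sides is killed on the left by all right inner products, and `d*`
  -- is itself a difference of two of these.
  refine eq_zero_of_star_mul_self ?_
  rw [star_sub, star_rinner, star_rinner, sub_mul, mul_sub, mul_sub, key', key', sub_self, sub_self,
    sub_self]

variable (E) in
/-- Left multiplication by `a` as an adjointable operator. -/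
def lsmulOperator (a : A) : AdjointableOperators A E where
  val :=
    { toFun := lsmul a
      map_add' := lsmul_add a
      map_smul' := fun c x => lsmul_smul c a x }
  property := by
    refine ⟨fun x b => ?_, ⟨lsmul (star a), rinner_lsmul a⟩, fun p => ⟨p a + 1,
      add_pos_of_nonneg_of_pos (apply_nonneg p.toSeminorm a) one_pos, fun x => ?_⟩⟩
    · change lsmul a (rsmul x b) = rsmul (lsmul a x) b
      refine rinner_left_ext (A := A) fun z => ?_
      rw [rinner_rsmul, ← star_star a, ← rinner_lsmul, ← rinner_lsmul, rinner_rsmul]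
    · refine (HilbertBimodule.rnorm_lsmul_le p a x).trans ?_
      exact mul_le_mul_of_nonneg_right (le_add_of_nonneg_right zero_le_one) (rnorm_nonneg p x)

theorem lsmulOperator_add (a b : A) :
    lsmulOperator E (a + b) = lsmulOperator E a + lsmulOperator E b := by
  ext x
  exact add_lsmul a b x

theorem lsmulOperator_smul (c : ℂ) (a : A) : lsmulOperator E (c • a) = c • lsmulOperator E a := by
  ext x
  exact smul_lsmul c a x

theorem lsmulOperator_mul (a b : A) :
    lsmulOperator E (a * b) = lsmulOperator E a * lsmulOperator E b := by
  ext x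
  exact mul_lsmul a b x

theorem lsmulOperator_linner (x y : E) : lsmulOperator E (linner x y : A) = theta x y := by
  ext z
  exact HilbertBimodule.linner_lsmul x y z

/-- Makes `a ↦ L_a` contractive, so limits produced by functional calculus in `A` pass to operators.
-/
theorem opSeminorm_lsmulOperator_le (p : ContCStarSeminorm A) (a : A) :
    opSeminorm p (lsmulOperator E a) ≤ p a := by
  rw [opSeminorm_apply]
  refine csSup_le ⟨_, 0, (rnorm_zero p).le.trans zero_le_one, rfl⟩ ?_
  rintro _ ⟨x, hx, rfl⟩
  exact (HilbertBimodule.rnorm_lsmul_le p a x).trans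
    (mul_le_of_le_one_right (apply_nonneg p.toSeminorm a) hx)

variable (A E) in
/-- The linear span of the left inner products. -/
def linnerSpan : Submodule ℂ A := Submodule.span ℂ {a | ∃ x y : E, a = linner x y}

theorem linner_mem_linnerSpan (x y : E) : (linner x y : A) ∈ linnerSpan A E :=
  Submodule.subset_span ⟨x, y, rfl⟩

theorem mul_mem_linnerSpan (a : A) {b : A} (hb : b ∈ linnerSpan A E) : a * b ∈ linnerSpan A E := by
  induction hb using Submodule.span_induction with
  | mem b hb =>
    obtain ⟨x, y, rfl⟩ := hb
    rw [← lsmul_linner]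
    exact linner_mem_linnerSpan _ _
  | zero => rw [mul_zero]; exact Submodule.zero_mem _
  | add b c _ _ hb hc => rw [mul_add]; exact Submodule.add_mem _ hb hc
  | smul r b _ hb => rw [mul_smul_comm]; exact Submodule.smul_mem _ r hb

theorem star_mem_linnerSpan {b : A} (hb : b ∈ linnerSpan A E) : star b ∈ linnerSpan A E := by
  induction hb using Submodule.span_induction with
  | mem b hb =>
    obtain ⟨x, y, rfl⟩ := hb
    rw [star_linner]
    exact linner_mem_linnerSpan _ _
  | zero => rw [star_zero]; exact Submodule.zero_mem _
  | add b c _ _ hb hc => rw [star_add]; exact Submodule.add_mem _ hb hc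
  | smul r b _ hb => rw [star_smul]; exact Submodule.smul_mem _ _ hb

theorem lsmulOperator_mem_finiteRank {b : A} (hb : b ∈ linnerSpan A E) :
    lsmulOperator E b ∈ finiteRankOperators A E := by
  induction hb using Submodule.span_induction with
  | mem b hb =>
    obtain ⟨x, y, rfl⟩ := hb
    rw [lsmulOperator_linner]
    exact Submodule.subset_span ⟨x, y, rfl⟩
  | zero =>
    have h := lsmulOperator_smul (E := E) 0 (0 : A)
    rw [zero_smul, zero_smul] at h
    rw [h]
    exact Submodule.zero_mem _
  | add b c _ _ hb hc => rw [lsmulOperator_add]; exact Submodule.add_mem _ hb hc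
  | smul r b _ hb => rw [lsmulOperator_smul]; exact Submodule.smul_mem _ r hb

variable (A E) in
theorem withSeminorms_operatorTopology :
    @WithSeminorms ℂ (AdjointableOperators A E) (ContCStarSeminorm A) _ _ _
      (fun p : ContCStarSeminorm A => opSeminorm p) (operatorTopology A E) :=
  let _ := operatorTopology A E
  ⟨rfl⟩

theorem finiteRank_subset_compact {T : AdjointableOperators A E}
    (hT : T ∈ finiteRankOperators A E) : T ∈ CompactOperators A E :=
  @subset_closure _ (operatorTopology A E) _ _ hT

theorem lsmulOperator_mem_compact {c : ℕ → A} {g : A} (hc : ∀ n, c n ∈ linnerSpan A E)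
    (h : ∀ p : ContCStarSeminorm A, Tendsto (fun n => p (c n - g)) atTop (𝓝 0)) :
    lsmulOperator E g ∈ CompactOperators A E := by
  let _ := operatorTopology A E
  have hw := withSeminorms_operatorTopology A E
  have hlim : Tendsto (fun n => lsmulOperator E (c n)) atTop (𝓝 (lsmulOperator E g)) := by
    rw [hw.tendsto_nhds]
    intro p ε hε
    filter_upwards [(h p).eventually_lt_const hε] with n hn
    refine lt_of_le_of_lt ?_ hn
    have e : lsmulOperator E (c n) - lsmulOperator E g = lsmulOperator E (c n - g) := by
      rw [sub_eq_iff_eq_add, ← lsmulOperator_add, sub_add_cancel]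
    rw [e]
    exact opSeminorm_lsmulOperator_le p _
  exact mem_closure_of_tendsto hlim
    (Eventually.of_forall fun n => lsmulOperator_mem_finiteRank (hc n))

theorem eq_zero_of_opSeminorm {T : AdjointableOperators A E}
    (h : ∀ p : ContCStarSeminorm A, opSeminorm p T = 0) : T = 0 := by
  ext x
  change T.1 x = 0
  rw [← rinner_self_eq_zero (A := A)]
  refine eq_zero_of_seminorms fun p => ?_
  have h1 := rnorm_apply_le p T x
  rw [h p, zero_mul] at h1
  rw [← rnorm_sq, le_antisymm h1 (rnorm_nonneg p _), zero_pow two_ne_zero]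

/-- Over a commutative algebra, compact operators commute with left multiplications. -/
theorem compact_mul_lsmulOperator (hcomm : ∀ a b : A, a * b = b * a)
    {S : AdjointableOperators A E} (hS : S ∈ CompactOperators A E) (a : A) :
    S * lsmulOperator E a = lsmulOperator E a * S := by
  let _ := operatorTopology A E
  have hw := withSeminorms_operatorTopology A E
  have := hw.topologicalAddGroup
  have : T1Space (AdjointableOperators A E) := hw.T1_of_separating fun T hT => by
    by_contra! h
    exact hT (eq_zero_of_opSeminorm h)
  -- The commutant of `L_a` is closed since the operator topology is Hausdorff, so commutation only
  -- has to be checked on finite-rank operators.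
  have hcl := isClosed_eq (continuous_mul_right_operator (lsmulOperator E a))
    (continuous_mul_left_operator (lsmulOperator E a))
  refine closure_minimal (s := (finiteRankOperators A E : Set (AdjointableOperators A E)))
    ?_ hcl hS
  intro T hT
  change T * lsmulOperator E a = lsmulOperator E a * T
  induction hT using Submodule.span_induction with
  | mem T hT =>
    obtain ⟨x, y, rfl⟩ := hT
    rw [← lsmulOperator_linner, ← lsmulOperator_mul, ← lsmulOperator_mul, hcomm]
  | zero => rw [zero_mul, mul_zero]
  | add T T' _ _ h h' => rw [add_mul, mul_add, h, h']
  | smul r T _ h => rw [smul_mul_assoc, mul_smul_comm, h]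

end LeftMultiplication

/-! ### Vanishing of derivations on the compact operators. -/

section Derivations

open RightPreHilbertModule LeftPreHilbertModule Filter Topology

/-- A cube root, unlike a square root, is defined and continuous on all of `ℝ`, so self-adjoint
elements need no splitting into positive and negative parts. -/
theorem exists_continuous_cube_root :
    ∃ f : ℝ → ℝ, Continuous f ∧ f 0 = 0 ∧ ∀ t, f t ^ 3 = t := by
  have hodd : Odd 3 := by decide
  have hsurj : Function.Surjective (fun t : ℝ => t ^ 3) :=
    (continuous_pow 3).surjective (tendsto_pow_atTop three_ne_zero)
      (by
        rw [← tendsto_neg_atTop_iff]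
        refine ((tendsto_pow_atTop three_ne_zero).comp tendsto_neg_atBot_atTop).congr fun t => ?_
        exact hodd.neg_pow t)
  let e := (hodd.strictMono_pow (R := ℝ)).orderIsoOfSurjective _ hsurj
  have he : ∀ t, e.symm t ^ 3 = t := fun t => e.apply_symm_apply t
  exact ⟨e.symm, e.symm.continuous, pow_eq_zero_iff three_ne_zero |>.1 (he 0), he⟩

variable {A E : Type*} [NonUnitalRing A] [StarRing A] [Module ℂ A] [IsScalarTower ℂ A A]
  [SMulCommClass ℂ A A] [StarModule ℂ A] [UniformSpace A] [ProCStarAlgebra A]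
  [AddCommGroup E] [Module ℂ E] [HilbertBimodule A E]

/-- Left multiplication by an element of the span of the left inner products, as a compact
operator. -/
def lsmulCompact : linnerSpan A E →ₗ[ℂ] CompactOperators A E where
  toFun b := ⟨lsmulOperator E b.1, finiteRank_subset_compact (lsmulOperator_mem_finiteRank b.2)⟩
  map_add' _ _ := Subtype.ext (lsmulOperator_add _ _)
  map_smul' _ _ := Subtype.ext (lsmulOperator_smul _ _)

variable {D : CompactOperators A E →ₗ[ℂ] CompactOperators A E}

/-- With `g` the cube root of `b` and `G = L_g`, the Leibniz rule for `G · G²` and commutativity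
bring a factor `G` to the left of `D(L_b)`; it contributes `χ(g) = 0`. -/
theorem IsDerivation.character_apply_eq_zero (hcomm : ∀ a b : A, a * b = b * a)
    (hD : IsDerivation D) (b : linnerSpan A E) (hb : star b.1 = b.1) (p : ContCStarSeminorm A)
    (χ : A →⋆ₙₐ[ℂ] ℂ) (hχ : ∀ a, ‖χ a‖ ≤ p a) (h0 : χ b.1 = 0) (u v : E) :
    χ (linner ((D (lsmulCompact b)).1.1 u) v) = 0 := by
  obtain ⟨f, hf, hf0, hf3⟩ := exists_continuous_cube_root
  obtain ⟨c, g, hc, hlim, hg⟩ := exists_tendsto_apply hcomm (linnerSpan A E) b.2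
    (fun c _ => mul_mem_linnerSpan c b.2) hb hf hf0
  have hgb : g * (g * g) = b.1 := by
    rw [← sub_eq_zero]
    refine eq_zero_of_characters hcomm fun q ψ hψ => ?_
    rw [map_sub, map_mul, map_mul, hg q ψ hψ, ← character_selfAdjoint ψ hb, sub_eq_zero]
    simp only [Complex.ofReal_re]
    exact_mod_cast (by rw [← pow_two, ← pow_succ', hf3])
  have hχg : χ g = 0 := by rw [hg p χ hχ, h0, Complex.zero_re, hf0, Complex.ofReal_zero]
  -- `g` may lie outside the span of the left inner products, but `L_g` is still in the closure, so
  -- `D` may be applied to it.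
  let G : CompactOperators A E := ⟨lsmulOperator E g, lsmulOperator_mem_compact hc hlim⟩
  have hG : lsmulCompact b = G * (G * G) := by
    refine Subtype.ext ?_
    change lsmulOperator E b.1 = lsmulOperator E g * (lsmulOperator E g * lsmulOperator E g)
    rw [← lsmulOperator_mul, ← lsmulOperator_mul, hgb]
  have hcG : ∀ S : CompactOperators A E, S * G = G * S := fun S =>
    Subtype.ext (compact_mul_lsmulOperator hcomm S.2 g)
  have hDG : D (lsmulCompact b) = G * (D G * G + D (G * G)) := by
    rw [hG, hD, ← mul_assoc, hcG, mul_add]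
  rw [hDG]
  change χ (linner (lsmul g ((D G * G + D (G * G)).1.1 u)) v) = 0
  rw [lsmul_linner, map_mul, hχg, zero_mul]

set_option synthInstance.maxHeartbeats 200000 in
-- At a character with `χ(a) ≠ 0`, the element `a² - χ(a)a` of the span stands in for `a - χ(a)1`.
theorem IsDerivation.lsmulCompact_selfAdjoint (hcomm : ∀ a b : A, a * b = b * a)
    (hD : IsDerivation D) (a : linnerSpan A E) (ha : star a.1 = a.1) :
    D (lsmulCompact a) = 0 := by
  have key : ∀ u v : E, (linner ((D (lsmulCompact a)).1.1 u) v : A) = 0 := by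
    intro u v
    refine eq_zero_of_characters hcomm fun p χ hχ => ?_
    by_cases h0 : χ a.1 = 0
    · exact hD.character_apply_eq_zero hcomm a ha p χ hχ h0 u v
    let a2 : linnerSpan A E := ⟨a.1 * a.1, mul_mem_linnerSpan _ a.2⟩
    -- This element is self-adjoint because `χ(a)` is real.
    have h1 := hD.character_apply_eq_zero hcomm (a2 + (-χ a.1) • a) (by
      change star (a.1 * a.1 + (-χ a.1) • a.1) = a.1 * a.1 + (-χ a.1) • a.1
      rw [star_add, star_mul, star_smul, ha, star_neg, ← map_star, ha]) p χ hχ (by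
      change χ (a.1 * a.1 + (-χ a.1) • a.1) = 0
      rw [map_add, map_mul, map_smul, smul_eq_mul, neg_mul, add_neg_cancel]) u v
    have h2 : lsmulCompact a2 = lsmulCompact a * lsmulCompact a :=
      Subtype.ext (lsmulOperator_mul _ _)
    have h3 : D (lsmulCompact a) * lsmulCompact a = lsmulCompact a * D (lsmulCompact a) :=
      Subtype.ext (compact_mul_lsmulOperator hcomm (D (lsmulCompact a)).2 a.1)
    rw [map_add, map_smul, map_add, map_smul, h2, hD, h3] at h1
    change χ (linner (lsmul a.1 ((D (lsmulCompact a)).1.1 u) + lsmul a.1 ((D (lsmulCompact a)).1.1 u)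
      + (-χ a.1) • (D (lsmulCompact a)).1.1 u) v) = 0 at h1
    -- With `t = χ(_A⟨D(L_a)u, v⟩)`, the relation reads `χ(a)t + χ(a)t - χ(a)t = 0`, leaving `χ(a)t
    -- = 0`.
    rw [add_linner, add_linner, lsmul_linner, smul_linner, map_add, map_add, map_mul, map_smul,
      smul_eq_mul, neg_mul, add_neg_cancel_right] at h1
    exact (mul_eq_zero.1 h1).resolve_left h0
  refine Subtype.ext (Subtype.ext (LinearMap.ext fun u => ?_))
  change (D (lsmulCompact a)).1.1 u = 0
  rw [← linner_self_eq_zero (A := A)]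
  exact key u _

set_option synthInstance.maxHeartbeats 200000 in
theorem IsDerivation.lsmulCompact_eq_zero (hcomm : ∀ a b : A, a * b = b * a)
    (hD : IsDerivation D) (a : linnerSpan A E) : D (lsmulCompact a) = 0 := by
  let s : linnerSpan A E := ⟨star a.1, star_mem_linnerSpan a.2⟩
  have h1 := hD.lsmulCompact_selfAdjoint hcomm (a + s) (by
    change star (a.1 + star a.1) = a.1 + star a.1
    rw [star_add, star_star, add_comm])
  have h2 := hD.lsmulCompact_selfAdjoint hcomm (Complex.I • (a - s)) (by
    change star (Complex.I • (a.1 - star a.1)) = Complex.I • (a.1 - star a.1)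
    rw [star_smul, star_sub, star_star, Complex.star_def, Complex.conj_I]
    module)
  -- Decomposition into real and imaginary parts, both inside the span, which is closed under the
  -- involution.
  have e : a = (1 / 2 : ℂ) • (a + s) + (-Complex.I / 2) • (Complex.I • (a - s)) := by
    rw [smul_smul, div_mul_eq_mul_div, neg_mul, Complex.I_mul_I, neg_neg]
    module
  rw [e, map_add, map_add, map_smul, map_smul, map_smul, h1, map_smul, h2, smul_zero, smul_zero, add_zero]

theorem IsDerivation.eq_zero (hcomm : ∀ a b : A, a * b = b * a) (hD : IsDerivation D) : D = 0 := by
  refine LinearMap.ext fun T => Subtype.ext (Subtype.ext (LinearMap.ext fun x => ?_))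
  change (D T).1.1 x = 0
  have hθ : ∀ x y : E, D (lsmulCompact ⟨linner x y, linner_mem_linnerSpan x y⟩) = 0 := fun x y =>
    hD.lsmulCompact_eq_zero hcomm _
  set z := (D T).1.1 x with hz
  -- Both `θ_{x,z}` and `T θ_{x,z} = θ_{Tx,z}` are annihilated by `D`, so the Leibniz rule leaves
  -- `D(T) θ_{x,z} = 0`.
  have h1 := hD T (lsmulCompact ⟨linner x z, linner_mem_linnerSpan x z⟩)
  have h2 : T * lsmulCompact ⟨linner x z, linner_mem_linnerSpan x z⟩
      = lsmulCompact ⟨linner (T.1.1 x) z, linner_mem_linnerSpan _ _⟩ := by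
    refine Subtype.ext ?_
    change T.1 * lsmulOperator E (linner x z) = lsmulOperator E (linner (T.1.1 x) z)
    rw [lsmulOperator_linner, lsmulOperator_linner]
    ext w
    exact T.1.2.1 x (rinner z w)
  rw [h2, hθ, hθ, mul_zero, add_zero] at h1
  have h3 : (D T).1.1 (lsmul (linner x z : A) z) = 0 :=
    (congrArg (fun S : CompactOperators A E => S.1.1 z) h1).symm
  rw [HilbertBimodule.linner_lsmul, (D T).1.2.1, ← hz] at h3
  exact eq_zero_of_rsmul_rinner_self h3

end Derivations
end ProCStar

theorem mainTheorem2 {A E : Type*}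
    [NonUnitalRing A] [StarRing A] [Module ℂ A] [IsScalarTower ℂ A A] [SMulCommClass ℂ A A]
    [StarModule ℂ A] [UniformSpace A] [ProCStar.ProCStarAlgebra A]
    [AddCommGroup E] [Module ℂ E] [ProCStar.HilbertBimodule A E]
    (hcomm : ∀ a b : A, a * b = b * a)
    (D : ProCStar.CompactOperators A E →ₗ[ℂ] ProCStar.CompactOperators A E)
    (hD : ProCStar.IsDerivation D) :
    D = 0 :=
  hD.eq_zero hcomm
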